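/- Let $\mathbb N=\{0,1,2,\dots\}$. For $k\in\mathbb N$ let $[\mathbb N]^k$ be the set of $k$-element subsets of $\mathbb N$, each written in increasing order as $\overline n=(n_1,\dots,n_k)$ with $n_1<\dots<n_k$. Make $[\mathbb N]^k$ a graph by declaring $\overline m\neq\overline n$ adjacent if and only if $$n_1\le m_1\le n_2\le m_2\le\dots\le n_k\le m_k\quad\text{or}\quad m_1\le n_1\le m_2\le n_2\le\dots\le m_k\le n_k ,$$ and let $d^k_{\mathbb K}$ be the shortest path distance of this (connected) graph. A real Banach space $X$ is called quasi-reflexive if the image of the canonical embedding of $X$ into its bidual $X^{**}$ has finite codimension in $X^{**}$. **Proposition 4.3 (Motakis).** There exists a quasi-reflexive real Banach space $X$ into which the family $([\mathbb N]^k,d^k_{\mathbb K})_{k\in\mathbb N}$ equi-Lipschitz embeds; that is, there are constants $A,B>0$ and maps $f_k\colon[\mathbb N]^k\to X$ $(k\in\mathbb N)$ such that for all $k\in\mathbb N$ and all $\overline n,\overline m\in[\mathbb N]^k$, $$A\,d^k_{\mathbb K}(\overline n,\overline m)\le\|f_k(\overline n)-f_k(\overline m)\|_X\le B\,d^k_{\mathbb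 K}(\overline n,\overline m).$$ -/

import Mathlib

/-- A real normed space `X` is quasi-reflexive if the image of the canonical embedding of `X` into
its bidual has finite codimension in the bidual. -/
def IsQuasiReflexive (X : Type*) [NormedAddCommGroup X] [NormedSpace ℝ X] : Prop :=
  FiniteDimensional ℝ
    (StrongDual ℝ (StrongDual ℝ X) ⧸ (NormedSpace.inclusionInDoubleDual ℝ X).range)

/-- A family of metric spaces equi-Lipschitz embeds into a metric space `N` if its members admit
bi-Lipschitz embeddings into `N` with constants that do not depend on the member. -/
def EquiLipschitzEmbeds {I : Type*} (M : I → Type*) [∀ i, MetricSpace (M i)]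
    (N : Type*) [MetricSpace N] : Prop :=
  ∃ A B : ℝ, 0 < A ∧ 0 < B ∧ ∃ f : ∀ i, M i → N, ∀ (i : I) (x y : M i),
    A * dist x y ≤ dist (f i x) (f i y) ∧ dist (f i x) (f i y) ≤ B * dist x y

/-- The set `[ℕ]^k` of `k`-element subsets of `ℕ`, each one listed in increasing order
`n 0 < n 1 < ... < n (k - 1)`. -/
def KaltonVertex (k : ℕ) : Type := Fin k ↪o ℕ

namespace KaltonVertex

instance (k : ℕ) : CoeFun (KaltonVertex k) (fun _ => Fin k → ℕ) :=
  ⟨(DFunLike.coe : (Fin k ↪o ℕ) → Fin k → ℕ)⟩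

/-- The chain of inequalities `n₁ ≤ m₁ ≤ n₂ ≤ m₂ ≤ ... ≤ nₖ ≤ mₖ`. -/
def Interlaced {k : ℕ} (n m : KaltonVertex k) : Prop :=
  (∀ i : Fin k, n i ≤ m i) ∧ ∀ i j : Fin k, (i : ℕ) + 1 = j → m i ≤ n j

/-- The Kalton interlaced graph on `[ℕ]^k`. -/
def graph (k : ℕ) : SimpleGraph (KaltonVertex k) where
  Adj m n := m ≠ n ∧ (Interlaced n m ∨ Interlaced m n)
  symm := ⟨fun _ _ h => ⟨h.1.symm, h.2.symm⟩⟩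
  loopless := ⟨fun _ h => h.1 rfl⟩

theorem graph_reachable_of_interlaced {k : ℕ} {n m : KaltonVertex k} (h : Interlaced n m) :
    (graph k).Reachable n m := by
  by_cases e : n = m
  · rw [e]
  · exact SimpleGraph.Adj.reachable (show (graph k).Adj n m from ⟨e, Or.inr h⟩)

theorem graph_reachable_far {k : ℕ} (n : KaltonVertex k) (N : ℕ) (hN : ∀ i, n i ≤ N)
    (p : KaltonVertex k) (hp : ∀ i : Fin k, p i = N + 1 + k + i) :
    (graph k).Reachable n p := by
  have hn : ∀ i j : Fin k, i < j → n i < n j := fun i j h => OrderEmbedding.strictMono n h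
  let a : ℕ → ℕ := fun j => if h : j < k then n ⟨j, h⟩ else N + 1 + j
  have ha : StrictMono a := by
    intro i j hij
    simp only [a]
    split_ifs with h1 h2 h2
    · exact hn _ _ hij
    · have := hN ⟨i, h1⟩
      omega
    · omega
    · omega
  let w : ℕ → KaltonVertex k := fun r =>
    OrderEmbedding.ofStrictMono (fun i : Fin k => a (r + i))
      (fun i j hij => ha (Nat.add_lt_add_left hij r))
  have hw : ∀ r (i : Fin k), w r i = a (r + i) := fun r i => rfl
  have hr : ∀ r, (graph k).Reachable (w 0) (w r) := by
    intro r
    induction r with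
    | zero => exact SimpleGraph.Reachable.refl _
    | succ r ih =>
      refine ih.trans (graph_reachable_of_interlaced ⟨fun i => ?_, fun i j hij => ?_⟩)
      · rw [hw, hw]
        exact ha.monotone (by omega)
      · rw [hw, hw]
        exact ha.monotone (by omega)
  have h0 : w 0 = n := by
    refine DFunLike.ext (F := Fin k ↪o ℕ) _ _ fun i => ?_
    change a (0 + i) = n i
    simp [a]
  have hk : w k = p := by
    refine DFunLike.ext (F := Fin k ↪o ℕ) _ _ fun i => ?_
    refine Eq.trans ?_ (hp i).symm
    change a (k + i) = _
    simp [a]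
    omega
  have := hr k
  rwa [h0, hk] at this

theorem graph_connected (k : ℕ) : (graph k).Connected := by
  have far : ∀ N : ℕ, ∃ p : KaltonVertex k, ∀ i : Fin k, p i = N + 1 + k + i := fun N =>
    ⟨OrderEmbedding.ofStrictMono (fun i : Fin k => N + 1 + k + i)
      (fun i j hij => Nat.add_lt_add_left hij _), fun i => rfl⟩
  have : Nonempty (KaltonVertex k) := ⟨(far 0).choose⟩
  refine SimpleGraph.Connected.mk fun n m => ?_
  have hb : ∀ i, n i ≤ (∑ i, n i) + ∑ i, m i := fun i =>
    (Finset.single_le_sum (f := fun i => n i) (fun _ _ => Nat.zero_le _)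
      (Finset.mem_univ i)).trans (Nat.le_add_right _ _)
  have hb' : ∀ i, m i ≤ (∑ i, n i) + ∑ i, m i := fun i =>
    (Finset.single_le_sum (f := fun i => m i) (fun _ _ => Nat.zero_le _)
      (Finset.mem_univ i)).trans (Nat.le_add_left _ _)
  obtain ⟨p, hp⟩ := far ((∑ i, n i) + ∑ i, m i)
  exact (graph_reachable_far n _ hb p hp).trans (graph_reachable_far m _ hb' p hp).symm

/-- `[ℕ]^k` carries the shortest path distance of the Kalton interlaced graph. -/
noncomputable instance (k : ℕ) : MetricSpace (KaltonVertex k) where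
  dist n m := ((graph k).dist n m : ℝ)
  dist_self n := by simp
  dist_comm n m := by rw [SimpleGraph.dist_comm]
  dist_triangle n m l := by exact_mod_cast (graph_connected k).dist_triangle
  eq_of_dist_eq_zero h := (graph_connected k).dist_eq_zero_iff.1 (by exact_mod_cast h)

end KaltonVertex

/-! In `c₀`, send a vertex `n` of `[ℕ]^k` to the sum of the summing-basis vectors `step (n i + k)`.
The coordinates of this sum are tail counts. They change by at most 1 along an edge, and conversely
they control the graph distance up to a factor 2, so these maps are bi-Lipschitz with uniform
constants. Let `slopes` be the set of all normalized differences, over all `k`. The space is the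
Davis–Figiel–Johnson–Pełczyński interpolation space of `slopes`: every slope lifts to it with norm
at most 2, so the embeddings survive.

For quasi-reflexivity, a bidual vector of the interpolation space induces `w` in the bidual of `c₀`,
bounded on all test functionals. If the sequence `w (coord i)` oscillated, averages of differences
`coord q - coord p` along sparse blocks could be added up to a test functional on which `w` is
arbitrarily large (`exists_sum_of_block_averages`, `cauchySeq_of_forall_testSet`). The shift by `k`
matters here: slopes of large `k` only involve late `step`s and miss the early blocks, while slopes
of small `k` have few terms and are flattened by long averages. So `w (coord i)` converges. If the
limit is 0, then `w` is a vector of `c₀`, and the bidual vector lies in the canonical image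
(`mem_range_of_forall_apply_eq`). The canonical image thus contains the kernel of one linear
functional, so its codimension is at most 1. -/

/-! ### Tail counts and the Kalton distance -/

namespace KaltonVertex

/-- The number of elements of `n`, shifted by `k`, which are at least `t`. -/
noncomputable def tailCount {k : ℕ} (n : KaltonVertex k) (t : ℕ) : ℝ :=
  ∑ i : Fin k, if t ≤ n i + k then 1 else 0

theorem tailCount_eq_card {k : ℕ} (n : KaltonVertex k) (t : ℕ) :
    n.tailCount t = ((Finset.univ.filter fun i : Fin k => t ≤ n i + k).card : ℝ) := by
  simp [tailCount]

theorem tailCount_le_of_interlaced {k : ℕ} {n m : KaltonVertex k} (h : Interlaced n m) (t : ℕ) :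
    n.tailCount t ≤ m.tailCount t := by
  refine Finset.sum_le_sum fun i _ => ?_
  have := h.1 i
  split_ifs <;> first | omega | norm_num

/-- Compare `m i` with `n (i + 1)`: only the last element of `m` is left unmatched, and it counts
for at most 1. -/
theorem tailCount_le_add_one_of_interlaced {k : ℕ} {n m : KaltonVertex k} (h : Interlaced n m)
    (t : ℕ) : m.tailCount t ≤ n.tailCount t + 1 := by
  cases k with
  | zero => simp [tailCount]
  | succ K =>
    unfold tailCount
    rw [Fin.sum_univ_castSucc, Fin.sum_univ_succ (n := K)]
    have h1 : ∑ i : Fin K, (if t ≤ m i.castSucc + (K + 1) then (1 : ℝ) else 0) ≤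
        ∑ i : Fin K, (if t ≤ n i.succ + (K + 1) then (1 : ℝ) else 0) := by
      refine Finset.sum_le_sum fun i _ => ?_
      have := h.2 i.castSucc i.succ (by simp)
      split_ifs <;> first | omega | norm_num
    have h2 : (if t ≤ m (Fin.last K) + (K + 1) then (1 : ℝ) else 0) ≤ 1 := by
      split_ifs <;> norm_num
    have h3 : 0 ≤ (if t ≤ n 0 + (K + 1) then (1 : ℝ) else 0) := by
      split_ifs <;> norm_num
    linarith

theorem abs_tailCount_sub_le_of_walk {k : ℕ} {n m : KaltonVertex k} (p : (graph k).Walk n m)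
    (t : ℕ) : |n.tailCount t - m.tailCount t| ≤ p.length := by
  induction p with
  | nil => simp
  | @cons u v w hadj p ih =>
    have h1 : |u.tailCount t - v.tailCount t| ≤ 1 := by
      rw [abs_le]
      rcases hadj.2 with h | h
      all_goals
        have := tailCount_le_of_interlaced h t
        have := tailCount_le_add_one_of_interlaced h t
        constructor <;> linarith
    have := abs_sub_le (u.tailCount t) (v.tailCount t) (w.tailCount t)
    rw [SimpleGraph.Walk.length_cons]
    push_cast
    linarith

theorem abs_tailCount_sub_le_dist {k : ℕ} (n m : KaltonVertex k) (t : ℕ) :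
    |n.tailCount t - m.tailCount t| ≤ dist n m := by
  obtain ⟨p, hp⟩ := (graph_connected k).exists_walk_length_eq_dist n m
  have := abs_tailCount_sub_le_of_walk p t
  rw [hp] at this
  exact this

/-- If `n j < m i`, then at least `k - i` elements of `m` but at most `k - 1 - j` elements of `n`
exceed `n j`; with `j = i + D` the counts differ by more than `D`. -/
theorem le_of_tailCount_sub_le {k : ℕ} {n m : KaltonVertex k} {D : ℕ}
    (h : ∀ t, m.tailCount t - n.tailCount t ≤ D) (i j : Fin k) (hij : (i : ℕ) + D = j) :
    m i ≤ n j := by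
  by_contra! hlt
  have h0 := h (n j + 1 + k)
  rw [tailCount_eq_card, tailCount_eq_card] at h0
  have h1 : (Finset.Ici i).card ≤
      (Finset.univ.filter fun l : Fin k => n j + 1 + k ≤ m l + k).card := by
    refine Finset.card_le_card fun l hl => ?_
    have : m i ≤ m l := (OrderEmbedding.monotone m) (Finset.mem_Ici.1 hl)
    simp only [Finset.mem_filter, Finset.mem_univ, true_and]
    omega
  have h2 : (Finset.univ.filter fun l : Fin k => n j + 1 + k ≤ n l + k).card ≤
      (Finset.Ioi j).card := by
    refine Finset.card_le_card fun l hl => ?_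
    simp only [Finset.mem_filter, Finset.mem_univ, true_and] at hl
    rw [Finset.mem_Ioi]
    by_contra! hle
    have : n l ≤ n j := (OrderEmbedding.monotone n) hle
    omega
  rw [Fin.card_Ici] at h1
  rw [Fin.card_Ioi] at h2
  have h3 : (Finset.univ.filter fun l : Fin k => n j + 1 + k ≤ m l + k).card ≤
      D + (Finset.univ.filter fun l : Fin k => n j + 1 + k ≤ n l + k).card := by
    have h4 := sub_le_iff_le_add.1 h0
    exact_mod_cast h4
  have := j.2
  omega

theorem dist_le_one_of_interlaced {k : ℕ} {n m : KaltonVertex k} (h : Interlaced n m) :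
    dist n m ≤ 1 := by
  by_cases e : n = m
  · simp [e]
  · have : (graph k).dist n m = 1 :=
      SimpleGraph.dist_eq_one_iff_adj.2 ⟨e, Or.inr h⟩
    change ((graph k).dist n m : ℝ) ≤ 1
    rw [this]
    simp

/-- The path shifts `n` to the left one index at a time, truncated from above by `p`; consecutive
vertices interlace, and after `D` shifts the truncation gives `p`. -/
theorem dist_le_of_le_of_le_shift {k : ℕ} {n p : KaltonVertex k} {D : ℕ}
    (hnp : ∀ i, n i ≤ p i) (h : ∀ i j : Fin k, (i : ℕ) + D = j → p i ≤ n j) :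
    dist n p ≤ D := by
  have hn : ∀ i j : Fin k, i < j → n i < n j := fun i j h => OrderEmbedding.strictMono n h
  have hp : ∀ i j : Fin k, i < j → p i < p j := fun i j h => OrderEmbedding.strictMono p h
  obtain ⟨N, hN⟩ : ∃ N, ∀ i, p i ≤ N := ⟨∑ i, p i, fun i =>
    Finset.single_le_sum (f := fun i => p i) (fun _ _ => Nat.zero_le _) (Finset.mem_univ i)⟩
  -- Past index `k` the values exceed every `p i`, so the minimum with `p i` is then `p i`.
  let a : ℕ → ℕ := fun j => if h : j < k then n ⟨j, h⟩ else N + 1 + j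
  have ha : StrictMono a := by
    intro i j hij
    simp only [a]
    split_ifs with h1 h2 h2
    · exact hn _ _ hij
    · have := hN ⟨i, h1⟩
      have := hnp ⟨i, h1⟩
      omega
    · omega
    · omega
  let w : ℕ → KaltonVertex k := fun r =>
    OrderEmbedding.ofStrictMono (fun i : Fin k => min (p i) (a (i + r)))
      (fun i j hij => min_lt_min (hp i j hij) (ha (Nat.add_lt_add_right hij r)))
  have hw : ∀ r (i : Fin k), w r i = min (p i) (a (i + r)) := fun r i => rfl
  have hr : ∀ r, dist (w 0) (w r) ≤ r := by
    intro r
    induction r with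
    | zero => simp
    | succ r ih =>
      have h1 : Interlaced (w r) (w (r + 1)) := by
        refine ⟨fun i => ?_, fun i j hij => ?_⟩
        · rw [hw, hw]
          exact min_le_min le_rfl (ha.monotone (by omega))
        · rw [hw, hw]
          refine min_le_min (hp i j (by rw [Fin.lt_def]; omega)).le (ha.monotone (by omega))
      have := dist_triangle (w 0) (w r) (w (r + 1))
      have := dist_le_one_of_interlaced h1
      push_cast
      linarith
  have h0 : w 0 = n := by
    refine DFunLike.ext (F := Fin k ↪o ℕ) _ _ fun i => ?_
    change min (p i) (a (i + 0)) = n i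
    simp [a, hnp i]
  have hD : w D = p := by
    refine DFunLike.ext (F := Fin k ↪o ℕ) _ _ fun i => ?_
    change min (p i) (a (i + D)) = p i
    rw [min_eq_left_iff]
    simp only [a]
    split_ifs with h1
    · exact h i ⟨_, h1⟩ rfl
    · have := hN i
      omega
  have := hr D
  rwa [h0, hD] at this

/-- Both vertices lie within `D` of their pointwise maximum. -/
theorem dist_le_two_mul {k : ℕ} {n m : KaltonVertex k} {D : ℕ}
    (h : ∀ t, |n.tailCount t - m.tailCount t| ≤ D) : dist n m ≤ 2 * D := by
  have h1 := le_of_tailCount_sub_le fun t => (le_abs_self _).trans (h t)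
  have h2 := le_of_tailCount_sub_le fun t => (le_abs_self _).trans
    ((abs_sub_comm _ _).trans_le (h t))
  have mono : ∀ (q : KaltonVertex k) (i j : Fin k), (i : ℕ) + D = j → q i ≤ q j :=
    fun q i j hij => OrderEmbedding.monotone q (by rw [Fin.le_def]; omega)
  let p : KaltonVertex k := OrderEmbedding.ofStrictMono (fun i : Fin k => max (n i) (m i))
    (fun i j hij => max_lt_max (OrderEmbedding.strictMono n hij) (OrderEmbedding.strictMono m hij))
  have hp : ∀ i, p i = max (n i) (m i) := fun i => rfl
  have hnp : dist n p ≤ D := dist_le_of_le_of_le_shift (fun i => by rw [hp]; exact le_max_left _ _)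
    fun i j hij => by rw [hp]; exact max_le (mono n i j hij) (h2 i j hij)
  have hmp : dist m p ≤ D := dist_le_of_le_of_le_shift (fun i => by rw [hp]; exact le_max_right _ _)
    fun i j hij => by rw [hp]; exact max_le (h1 i j hij) (mono m i j hij)
  have := dist_triangle_right n m p
  linarith

/-- Tail counts are integers, so `C` can be replaced by its floor. -/
theorem dist_le_two_mul_of_abs_le {k : ℕ} {n m : KaltonVertex k} {C : ℝ}
    (h : ∀ t, |n.tailCount t - m.tailCount t| ≤ C) : dist n m ≤ 2 * C := by
  have hC : 0 ≤ C := (abs_nonneg _).trans (h 0)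
  have h1 : dist n m ≤ 2 * (⌊C⌋₊ : ℕ) := by
    refine dist_le_two_mul fun t => ?_
    have h2 := h t
    rw [tailCount_eq_card, tailCount_eq_card] at h2 ⊢
    generalize (Finset.univ.filter fun i : Fin k => t ≤ n i + k).card = a at *
    generalize (Finset.univ.filter fun i : Fin k => t ≤ m i + k).card = b at *
    have h3 : |(a : ℝ) - b| = (((a : ℤ) - b).natAbs : ℕ) := by
      rw [Nat.cast_natAbs]
      push_cast
      rfl
    rw [h3] at h2 ⊢
    exact_mod_cast Nat.le_floor h2
  have := Nat.floor_le hC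
  linarith

end KaltonVertex

/-! ### Functionals on `ℓ²`-sums -/

section SquareSummable

theorem Finset.sum_sq_le_of_le_mul_sqrt {ι : Type*} {s : Finset ι} {c : ι → ℝ} {C : ℝ}
    (h : ∑ i ∈ s, c i ^ 2 ≤ C * √(∑ i ∈ s, c i ^ 2)) : ∑ i ∈ s, c i ^ 2 ≤ C ^ 2 := by
  have h0 : 0 ≤ ∑ i ∈ s, c i ^ 2 := Finset.sum_nonneg fun _ _ => sq_nonneg _
  generalize ∑ i ∈ s, c i ^ 2 = S at *
  have h1 := Real.sq_sqrt h0
  have h2 := Real.sqrt_nonneg S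
  rcases h2.eq_or_lt with h3 | h3
  · nlinarith [sq_nonneg C]
  · have : √S ≤ C := by nlinarith
    nlinarith

theorem ContinuousLinearMap.exists_norm_le_one_half_norm_le {E : Type*} [NormedAddCommGroup E]
    [NormedSpace ℝ E] (g : StrongDual ℝ E) : ∃ u : E, ‖u‖ ≤ 1 ∧ ‖g‖ / 2 ≤ g u := by
  rcases (norm_nonneg g).eq_or_lt with h | h
  · exact ⟨0, by simp, by simp [← h]⟩
  · obtain ⟨x, hx, hgx⟩ := g.exists_lt_apply_of_lt_opNorm (half_lt_self h)
    rcases le_total 0 (g x) with h0 | h0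
    · exact ⟨x, hx.le, by rw [Real.norm_of_nonneg h0] at hgx; exact hgx.le⟩
    · exact ⟨-x, by simpa using hx.le, by
        rw [Real.norm_of_nonpos h0] at hgx; simpa using hgx.le⟩

variable {E : ℕ → Type*} [∀ n, NormedAddCommGroup (E n)]

theorem lp.sum_norm_sq_le (v : lp E 2) (s : Finset ℕ) : ∑ n ∈ s, ‖v n‖ ^ 2 ≤ ‖v‖ ^ 2 := by
  have := lp.sum_rpow_le_norm_rpow (p := 2) (by norm_num) v s
  simpa using this

theorem lp.norm_sq_sum_single (u : ∀ n, E n) (s : Finset ℕ) :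
    ‖∑ n ∈ s, lp.single 2 n (u n)‖ ^ 2 = ∑ n ∈ s, ‖u n‖ ^ 2 := by
  have := lp.norm_sum_single (p := 2) (by norm_num) u s
  simpa using this

theorem lp.sum_mul_norm_le (c : ℕ → ℝ) (v : lp E 2) (s : Finset ℕ) :
    ∑ n ∈ s, c n * ‖v n‖ ≤ √(∑ n ∈ s, c n ^ 2) * ‖v‖ := by
  refine (Real.sum_mul_le_sqrt_mul_sqrt s c fun n => ‖v n‖).trans ?_
  refine mul_le_mul_of_nonneg_left ?_ (Real.sqrt_nonneg _)
  exact Real.sqrt_le_iff.2 ⟨norm_nonneg _, lp.sum_norm_sq_le v s⟩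

variable [∀ n, NormedSpace ℝ (E n)]

/-- Test `χ` on vectors that half-norm its components, weighted by the norms `c n` of these
components; the factor 2 pays for half-norming. -/
theorem lp.sum_sq_norm_comp_single_le (χ : StrongDual ℝ (lp E 2)) (s : Finset ℕ) :
    ∑ n ∈ s, ‖χ.comp (lp.singleContinuousLinearMap ℝ E 2 n)‖ ^ 2 ≤ (2 * ‖χ‖) ^ 2 := by
  apply Finset.sum_sq_le_of_le_mul_sqrt
  set c : ℕ → ℝ := fun n => ‖χ.comp (lp.singleContinuousLinearMap ℝ E 2 n)‖ with hc
  choose u hu hχu using fun n =>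
    (χ.comp (lp.singleContinuousLinearMap ℝ E 2 n)).exists_norm_le_one_half_norm_le
  have h1 : ‖∑ n ∈ s, lp.single (E := E) 2 n (c n • u n)‖ ≤ √(∑ n ∈ s, c n ^ 2) := by
    apply Real.le_sqrt_of_sq_le
    rw [lp.norm_sq_sum_single]
    refine Finset.sum_le_sum fun n _ => ?_
    rw [norm_smul, mul_pow, Real.norm_eq_abs, sq_abs]
    have := pow_le_one₀ (norm_nonneg (u n)) (hu n) (n := 2)
    nlinarith [sq_nonneg (c n)]
  have h2 : χ (∑ n ∈ s, lp.single (E := E) 2 n (c n • u n)) ≤ ‖χ‖ * √(∑ n ∈ s, c n ^ 2) :=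
    (le_abs_self _).trans ((χ.le_opNorm _).trans (mul_le_mul_of_nonneg_left h1 (norm_nonneg _)))
  have h3 : ∑ n ∈ s, c n ^ 2 / 2 ≤ χ (∑ n ∈ s, lp.single (E := E) 2 n (c n • u n)) := by
    rw [map_sum]
    refine Finset.sum_le_sum fun n _ => ?_
    rw [lp.single_smul, map_smul, smul_eq_mul]
    have h4 : c n / 2 ≤ χ (lp.single 2 n (u n)) := hχu n
    have h5 : 0 ≤ c n := norm_nonneg _
    nlinarith
  rw [← Finset.sum_div] at h3
  linarith

/-- A functional on an `ℓ²`-sum is the norm-convergent sum of its components. -/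
theorem lp.hasSum_comp_single_comp_eval (χ : StrongDual ℝ (lp E 2)) :
    HasSum (fun n => (χ.comp (lp.singleContinuousLinearMap ℝ E 2 n)).comp (lp.evalCLM ℝ E 2 n))
      χ := by
  have hs : Summable fun n =>
      (χ.comp (lp.singleContinuousLinearMap ℝ E 2 n)).comp (lp.evalCLM ℝ E 2 n) := by
    have hc : Summable fun n => ‖χ.comp (lp.singleContinuousLinearMap ℝ E 2 n)‖ ^ 2 :=
      summable_of_sum_le (fun _ => sq_nonneg _) (lp.sum_sq_norm_comp_single_le χ)
    rw [summable_iff_vanishing_norm] at hc ⊢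
    intro ε hε
    obtain ⟨s, hs⟩ := hc ((ε / 2) ^ 2) (by positivity)
    refine ⟨s, fun t ht => ?_⟩
    have h1 := hs t ht
    rw [Real.norm_of_nonneg (Finset.sum_nonneg fun _ _ => sq_nonneg _)] at h1
    refine lt_of_le_of_lt ?_ (half_lt_self hε)
    refine ContinuousLinearMap.opNorm_le_bound _ (by positivity) fun v => ?_
    rw [_root_.sum_apply]
    refine (norm_sum_le _ _).trans ?_
    refine le_trans (Finset.sum_le_sum fun n _ => (χ.comp
      (lp.singleContinuousLinearMap ℝ E 2 n)).le_opNorm (v n)) ((lp.sum_mul_norm_le _ v t).trans ?_)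
    refine mul_le_mul_of_nonneg_right ?_ (norm_nonneg _)
    exact Real.sqrt_le_iff.2 ⟨by positivity, h1.le⟩
  convert hs.hasSum
  ext v
  have h1 := (hs.hasSum).mapL (ContinuousLinearMap.apply ℝ ℝ v)
  have h2 := (lp.hasSum_single (p := 2) (by norm_num) v).mapL χ
  exact h2.unique h1

end SquareSummable

/-! ### The interpolation space and its bidual -/

namespace Interpolation

open scoped BoundedContinuousFunction

variable {Y : Type*} [NormedAddCommGroup Y] [NormedSpace ℝ Y] (W : Set Y)

/-- The functionals of norm at most `2 ^ n` which are bounded by `2 ^ (-n)` on `W`. -/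
def testSet (n : ℕ) : Set (StrongDual ℝ Y) :=
  {f | ‖f‖ ≤ 2 ^ n ∧ ∀ x ∈ W, |f x| ≤ (1 / 2) ^ n}

/-- Evaluation on the functionals in `testSet W n`. -/
noncomputable def evalMap (n : ℕ) : Y →L[ℝ] (testSet W n →ᵇ ℝ) :=
  LinearMap.mkContinuous
    { toFun := fun y => BoundedContinuousFunction.ofNormedAddCommGroup
        (fun f : testSet W n => f.1 y) (by fun_prop) (2 ^ n * ‖y‖)
        (fun f => (f.1.le_opNorm y).trans (mul_le_mul_of_nonneg_right f.2.1 (norm_nonneg _)))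
      map_add' := fun x y => by ext f; simp
      map_smul' := fun c y => by ext f; simp }
    (2 ^ n) fun y => BoundedContinuousFunction.norm_ofNormedAddCommGroup_le
      (f := fun f : testSet W n => f.1 y) _ (by positivity)
      (fun f => (f.1.le_opNorm y).trans (mul_le_mul_of_nonneg_right f.2.1 (norm_nonneg _)))

@[simp]
theorem evalMap_apply (n : ℕ) (y : Y) (f : testSet W n) : evalMap W n y f = f.1 y := rfl

theorem norm_evalMap_le {n : ℕ} {y : Y} (hy : y ∈ W) : ‖evalMap W n y‖ ≤ (1 / 2) ^ n :=
  (BoundedContinuousFunction.norm_le (by positivity)).2 fun f => f.2.2 y hy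

theorem exists_half_norm_evalMap_le (n : ℕ) (y : Y) :
    ∃ f ∈ testSet W n, ‖evalMap W n y‖ / 2 ≤ |f y| := by
  rcases (norm_nonneg (evalMap W n y)).eq_or_lt with h | h
  · exact ⟨0, ⟨by simp, fun x _ => by simp⟩, by simp [← h]⟩
  · by_contra! H
    have := (BoundedContinuousFunction.norm_le (f := evalMap W n y) (half_pos h).le).2
      fun f => (H f.1 f.2).le
    linarith

/-- The `ℓ²`-sum in which the sequences of evaluations live. -/
abbrev SeqSpace : Type _ := lp (fun n => testSet W n →ᵇ ℝ) 2

/-- The pairs consisting of a vector and the sequence of its evaluations. -/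
noncomputable def pairs : Submodule ℝ (Y × SeqSpace W) where
  carrier := {z | ∀ n, z.2 n = evalMap W n z.1}
  add_mem' := fun {a b} ha hb n => by
    simp only [Prod.snd_add, lp.coeFn_add, Pi.add_apply, Prod.fst_add, map_add, ha n, hb n]
  zero_mem' := fun n => by simp
  smul_mem' := fun c a ha n => by
    simp only [Prod.smul_snd, lp.coeFn_smul, Pi.smul_apply, Prod.smul_fst, map_smul, ha n]

theorem isClosed_pairs : IsClosed (pairs W : Set (Y × SeqSpace W)) := by
  have : (pairs W : Set (Y × SeqSpace W)) =
      ⋂ n, {z | lp.evalCLM ℝ (fun n => testSet W n →ᵇ ℝ) 2 n z.2 = evalMap W n z.1} := by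
    ext z
    simp only [Set.mem_iInter]
    rfl
  rw [this]
  exact isClosed_iInter fun n => isClosed_eq
    ((ContinuousLinearMap.continuous _).comp continuous_snd)
    ((ContinuousLinearMap.continuous _).comp continuous_fst)

/-- The Davis–Figiel–Johnson–Pełczyński interpolation space of a set `W`. -/
def Space : Type _ := pairs W

noncomputable instance : NormedAddCommGroup (Space W) :=
  inferInstanceAs (NormedAddCommGroup (pairs W))

noncomputable instance : NormedSpace ℝ (Space W) :=
  inferInstanceAs (NormedSpace ℝ (pairs W))

instance [CompleteSpace Y] : CompleteSpace (Space W) :=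
  (isClosed_pairs W).completeSpace_coe

/-- The inclusion of the interpolation space into the ambient space. -/
noncomputable def toAmbient : Space W →L[ℝ] Y :=
  (ContinuousLinearMap.fst ℝ Y (SeqSpace W)).comp (pairs W).subtypeL

/-- The sequence of evaluations of a vector of the interpolation space. -/
noncomputable def toSeq : Space W →L[ℝ] SeqSpace W :=
  (ContinuousLinearMap.snd ℝ Y (SeqSpace W)).comp (pairs W).subtypeL

variable {W}

theorem toSeq_apply (z : Space W) (n : ℕ) : toSeq W z n = evalMap W n (toAmbient W z) := z.2 n

theorem toAmbient_injective : Function.Injective (toAmbient W) := by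
  intro z z' h
  refine Subtype.ext (Prod.ext h (lp.ext (funext fun n => ?_)))
  exact (toSeq_apply z n).trans ((congrArg _ h).trans (toSeq_apply z' n).symm)

theorem norm_toAmbient_le (z : Space W) : ‖toAmbient W z‖ ≤ ‖z‖ := norm_fst_le z.1

theorem norm_toSeq_le (z : Space W) : ‖toSeq W z‖ ≤ ‖z‖ := norm_snd_le z.1

theorem abs_apply_le_norm_toSeq {n : ℕ} {f : StrongDual ℝ Y} (hf : f ∈ testSet W n)
    (z : Space W) : |f (toAmbient W z)| ≤ ‖toSeq W z n‖ := by
  rw [toSeq_apply]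
  exact (evalMap W n (toAmbient W z)).norm_coe_le_norm ⟨f, hf⟩

theorem exists_toAmbient_eq {y : Y} {C : ℝ}
    (h : ∀ s : Finset ℕ, ∑ n ∈ s, ‖evalMap W n y‖ ^ 2 ≤ C ^ 2) (hC : 0 ≤ C) (hy : ‖y‖ ≤ C) :
    ∃ z : Space W, toAmbient W z = y ∧ ‖z‖ ≤ C := by
  have hm : Memℓp (fun n => evalMap W n y) 2 := memℓp_gen' (C := C ^ 2) (by simpa using h)
  refine ⟨⟨(y, ⟨_, hm⟩), fun n => rfl⟩, rfl, ?_⟩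
  refine max_le hy ?_
  refine lp.norm_le_of_forall_sum_le (p := 2) (by norm_num) hC (by simpa using h)

theorem exists_toAmbient_eq_of_mem {y : Y} (hy : y ∈ W) (hy1 : ‖y‖ ≤ 1) :
    ∃ z : Space W, toAmbient W z = y ∧ ‖z‖ ≤ 2 := by
  refine exists_toAmbient_eq (fun s => ?_) (by norm_num) (hy1.trans (by norm_num))
  have h1 : ∑ n ∈ s, ‖evalMap W n y‖ ^ 2 ≤ ∑ n ∈ s, (1 / 2 : ℝ) ^ n := by
    refine Finset.sum_le_sum fun n _ => ?_
    have h2 := norm_evalMap_le W hy (n := n)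
    have h3 : (1 / 2 : ℝ) ^ n ≤ 1 := pow_le_one₀ (by norm_num) (by norm_num)
    nlinarith [norm_nonneg (evalMap W n y)]
  have h4 := summable_geometric_two.sum_le_tsum s (fun n _ => by positivity)
  rw [tsum_geometric_two] at h4
  linarith

/-- The functionals that extend to the ambient space are dense in the dual of the interpolation
space. -/
theorem bidual_eq_zero {Φ : StrongDual ℝ (StrongDual ℝ (Space W))}
    (h : ∀ ψ : StrongDual ℝ Y, Φ (ψ.comp (toAmbient W)) = 0) : Φ = 0 := by
  ext φ
  -- Hahn–Banach on `Y × SeqSpace W` splits `φ` into an ambient part and `χ ∘ toSeq`. Each component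
  -- of the latter factors through `evalMap W n`, hence through `toAmbient`, so `Φ` kills it, and
  -- norm convergence of the components passes this to the sum.
  obtain ⟨φ', hφ', -⟩ := exists_extension_norm_eq (pairs W) φ
  set χ := φ'.comp (ContinuousLinearMap.inr ℝ Y (SeqSpace W))
  have h1 : φ = (φ'.comp (ContinuousLinearMap.inl ℝ Y (SeqSpace W))).comp (toAmbient W) +
      χ.comp (toSeq W) := by
    ext z
    refine (hφ' z).symm.trans ?_
    change φ' z.1 = φ' (z.1.1, 0) + φ' (0, z.1.2)
    rw [← map_add]
    simp
  have h2 := ((lp.hasSum_comp_single_comp_eval χ).mapL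
    (ContinuousLinearMap.precomp ℝ (toSeq W))).mapL Φ
  have h3 : Φ (χ.comp (toSeq W)) = 0 := by
    refine h2.unique ?_
    convert hasSum_zero with n
    rw [← h ((χ.comp (lp.singleContinuousLinearMap ℝ (fun n => testSet W n →ᵇ ℝ) 2 n)).comp (evalMap W n))]
    congr 1
    ext z
    exact congrArg (χ.comp (lp.singleContinuousLinearMap ℝ (fun n => testSet W n →ᵇ ℝ) 2 n)) (toSeq_apply z n)
  rw [h1, map_add, h, h3]
  simp

theorem abs_bidual_apply_le (Φ : StrongDual ℝ (StrongDual ℝ (Space W))) {n : ℕ}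
    {f : StrongDual ℝ Y} (hf : f ∈ testSet W n) : |Φ (f.comp (toAmbient W))| ≤ ‖Φ‖ := by
  refine (Φ.le_opNorm _).trans (mul_le_of_le_one_right (norm_nonneg _) ?_)
  refine ContinuousLinearMap.opNorm_le_bound _ zero_le_one fun z => ?_
  rw [one_mul]
  exact (abs_apply_le_norm_toSeq hf z).trans
    ((lp.norm_apply_le_norm (by norm_num) _ n).trans (norm_toSeq_le z))

/-- A bidual vector of the interpolation space whose image in the bidual of the ambient space comes
from a vector does itself come from a vector. -/
theorem mem_range_of_forall_apply_eq {Φ : StrongDual ℝ (StrongDual ℝ (Space W))} {y : Y}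
    (h : ∀ ψ : StrongDual ℝ Y, Φ (ψ.comp (toAmbient W)) = ψ y) :
    Φ ∈ (NormedSpace.inclusionInDoubleDual ℝ (Space W)).range := by
  -- Testing `Φ` on `∑ f n y • f n` shows that the values `f n y` are square summable; since `f n`
  -- half-norms `evalMap W n y`, the vector `y` lifts to the interpolation space.
  choose f hf hfy using fun n => exists_half_norm_evalMap_le W n y
  have h1 : ∀ s : Finset ℕ, ∑ n ∈ s, |f n y| ^ 2 ≤ ‖Φ‖ ^ 2 := by
    intro s
    apply Finset.sum_sq_le_of_le_mul_sqrt
    have h2 : ‖(∑ n ∈ s, f n y • f n).comp (toAmbient W)‖ ≤ √(∑ n ∈ s, |f n y| ^ 2) := by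
      refine ContinuousLinearMap.opNorm_le_bound _ (Real.sqrt_nonneg _) fun z => ?_
      have h3 : ∑ n ∈ s, |f n y| * ‖toSeq W z n‖ ≤ √(∑ n ∈ s, |f n y| ^ 2) * ‖z‖ :=
        (lp.sum_mul_norm_le _ (toSeq W z) s).trans
          (mul_le_mul_of_nonneg_left (norm_toSeq_le z) (Real.sqrt_nonneg _))
      refine le_trans ?_ h3
      rw [ContinuousLinearMap.comp_apply, _root_.sum_apply]
      refine (norm_sum_le _ _).trans (Finset.sum_le_sum fun n _ => ?_)
      rw [_root_.smul_apply, norm_smul]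
      exact mul_le_mul_of_nonneg_left (abs_apply_le_norm_toSeq (hf n) z) (norm_nonneg _)
    have h4 : ∑ n ∈ s, |f n y| ^ 2 = Φ ((∑ n ∈ s, f n y • f n).comp (toAmbient W)) := by
      rw [h, _root_.sum_apply]
      refine Finset.sum_congr rfl fun n _ => ?_
      rw [_root_.smul_apply, smul_eq_mul, sq_abs, sq]
    calc ∑ n ∈ s, |f n y| ^ 2 = Φ ((∑ n ∈ s, f n y • f n).comp (toAmbient W)) := h4
      _ ≤ ‖Φ‖ * ‖(∑ n ∈ s, f n y • f n).comp (toAmbient W)‖ :=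
        (le_abs_self _).trans (Φ.le_opNorm _)
      _ ≤ _ := mul_le_mul_of_nonneg_left h2 (norm_nonneg Φ)
  obtain ⟨z, hz, -⟩ := exists_toAmbient_eq (W := W) (y := y) (C := 2 * ‖Φ‖ + ‖y‖)
    (fun s => by
      have h5 : ∑ n ∈ s, ‖evalMap W n y‖ ^ 2 ≤ ∑ n ∈ s, 4 * |f n y| ^ 2 := by
        refine Finset.sum_le_sum fun n _ => ?_
        have := hfy n
        nlinarith [norm_nonneg (evalMap W n y)]
      rw [← Finset.mul_sum] at h5
      have := h1 s
      nlinarith [norm_nonneg Φ, norm_nonneg y, mul_nonneg (norm_nonneg Φ) (norm_nonneg y)])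
    (by positivity) (by linarith [norm_nonneg Φ])
  refine ⟨z, ?_⟩
  rw [eq_comm, ← sub_eq_zero]
  refine bidual_eq_zero fun ψ => ?_
  rw [_root_.sub_apply, h, sub_eq_zero, ← hz]
  rfl

end Interpolation

/-! ### The space `c₀` and its dual -/

open scoped ZeroAtInfty

/-- The Banach space `c₀` of real null sequences. -/
def CZero : Type := C₀(ℕ, ℝ)

namespace CZero

noncomputable instance : NormedAddCommGroup CZero := inferInstanceAs (NormedAddCommGroup C₀(ℕ, ℝ))

noncomputable instance : NormedSpace ℝ CZero := inferInstanceAs (NormedSpace ℝ C₀(ℕ, ℝ))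

instance : CompleteSpace CZero := inferInstanceAs (CompleteSpace C₀(ℕ, ℝ))

instance : FunLike CZero ℕ ℝ := inferInstanceAs (FunLike C₀(ℕ, ℝ) ℕ ℝ)

@[simp]
theorem sub_apply (x y : CZero) (i : ℕ) : (x - y) i = x i - y i := rfl

@[simp]
theorem smul_apply (c : ℝ) (x : CZero) (i : ℕ) : (c • x) i = c * x i := rfl

/-- The sequence `x` as an element of `c₀`. -/
def ofTendsto (x : ℕ → ℝ) (h : Filter.Tendsto x Filter.atTop (nhds 0)) : CZero :=
  ZeroAtInftyContinuousMap.mk ⟨x, continuous_of_discreteTopology⟩ (by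
    rw [Filter.cocompact_eq_cofinite, Nat.cofinite_eq_atTop]
    exact h)

@[simp]
theorem ofTendsto_apply (x : ℕ → ℝ) (h : Filter.Tendsto x Filter.atTop (nhds 0)) (i : ℕ) :
    ofTendsto x h i = x i := rfl

theorem tendsto_zero (x : CZero) : Filter.Tendsto x Filter.atTop (nhds 0) := by
  have := ZeroAtInftyContinuousMap.zero_at_infty' x
  rwa [Filter.cocompact_eq_cofinite, Nat.cofinite_eq_atTop] at this

theorem norm_le {x : CZero} {C : ℝ} (hC : 0 ≤ C) : ‖x‖ ≤ C ↔ ∀ i, |x i| ≤ C := by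
  change ‖ZeroAtInftyContinuousMap.toBCF x‖ ≤ C ↔ _
  exact BoundedContinuousFunction.norm_le hC

theorem abs_apply_le (x : CZero) (i : ℕ) : |x i| ≤ ‖x‖ := (norm_le (norm_nonneg _)).1 le_rfl i

/-- The coordinate functionals on `c₀`. -/
noncomputable def coord (i : ℕ) : StrongDual ℝ CZero :=
  LinearMap.mkContinuous
    { toFun := fun x => x i
      map_add' := fun _ _ => rfl
      map_smul' := fun _ _ => rfl } 1 fun x => by
    rw [one_mul]
    exact abs_apply_le x i

@[simp]
theorem coord_apply (i : ℕ) (x : CZero) : coord i x = x i := rfl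

theorem norm_coord_le (i : ℕ) : ‖coord i‖ ≤ 1 :=
  LinearMap.mkContinuous_norm_le _ zero_le_one _

@[simp]
theorem sum_apply {ι : Type*} (s : Finset ι) (x : ι → CZero) (t : ℕ) :
    (∑ i ∈ s, x i) t = ∑ i ∈ s, x i t := map_sum (coord t) x s

/-- The summing basis of `c₀`. -/
def step (p : ℕ) : CZero :=
  ofTendsto (fun t => if t ≤ p then 1 else 0) <| by
    refine tendsto_const_nhds.congr' ?_
    filter_upwards [Filter.eventually_gt_atTop p] with t ht
    rw [if_neg (by omega)]

@[simp]
theorem step_apply (p t : ℕ) : step p t = if t ≤ p then 1 else 0 := rfl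

/-- The unit vector basis of `c₀`. -/
def unit (p : ℕ) : CZero :=
  ofTendsto (fun t => if t = p then 1 else 0) <| by
    refine tendsto_const_nhds.congr' ?_
    filter_upwards [Filter.eventually_gt_atTop p] with t ht
    rw [if_neg (by omega)]

@[simp]
theorem unit_apply (p t : ℕ) : unit p t = if t = p then 1 else 0 := rfl

theorem hasSum_smul_unit (x : CZero) : HasSum (fun i => x i • unit i) x := by
  rw [HasSum, SummationFilter.unconditional_filter, Metric.tendsto_atTop]
  intro ε hε
  obtain ⟨N, hN⟩ := Metric.tendsto_atTop.1 (tendsto_zero x) (ε / 2) (half_pos hε)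
  refine ⟨Finset.range N, fun s hs => ?_⟩
  refine lt_of_le_of_lt ?_ (half_lt_self hε)
  rw [dist_eq_norm, norm_le (by positivity)]
  intro t
  by_cases ht : t ∈ s
  · simp [ht]
    positivity
  · have h1 : N ≤ t := by
      by_contra! h
      exact ht (hs (Finset.mem_range.2 h))
    have := hN t h1
    rw [Real.dist_eq, sub_zero] at this
    simp [ht]
    exact this.le

/-- The dual of `c₀` is `ℓ¹`: signed finite sums of unit vectors have norm at most 1, so the
coefficients `ψ (unit i)` are absolutely summable. -/
theorem hasSum_smul_coord (ψ : StrongDual ℝ CZero) :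
    HasSum (fun i => ψ (unit i) • coord i) ψ := by
  have hs : Summable fun i => ψ (unit i) • coord i := by
    refine Summable.of_norm (summable_of_sum_le (c := ‖ψ‖) (fun _ => norm_nonneg _) fun s => ?_)
    have h1 : ‖∑ i ∈ s, (SignType.sign (ψ (unit i)) : ℝ) • unit i‖ ≤ 1 := by
      rw [norm_le zero_le_one]
      intro t
      simp only [sum_apply, smul_apply, unit_apply, mul_ite,
        mul_one, mul_zero, Finset.sum_ite_eq]
      split_ifs
      · rcases lt_trichotomy (ψ (unit t)) 0 with h | h | h <;> simp [h]
      · simp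
    calc ∑ i ∈ s, ‖ψ (unit i) • coord i‖ ≤ ∑ i ∈ s, |ψ (unit i)| := by
          refine Finset.sum_le_sum fun i _ => ?_
          rw [norm_smul]
          exact mul_le_of_le_one_right (norm_nonneg _) (norm_coord_le i)
      _ = ψ (∑ i ∈ s, (SignType.sign (ψ (unit i)) : ℝ) • unit i) := by
          rw [map_sum]
          refine Finset.sum_congr rfl fun i _ => ?_
          rw [map_smul, smul_eq_mul, sign_mul_self]
      _ ≤ ‖ψ‖ := (le_abs_self _).trans
          ((ψ.le_opNorm _).trans (mul_le_of_le_one_right (norm_nonneg _) h1))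
  convert hs.hasSum
  ext x
  have h1 := hs.hasSum.mapL (ContinuousLinearMap.apply ℝ ℝ x)
  have h2 := (hasSum_smul_unit x).mapL ψ
  have h3 : (fun i => ψ (x i • unit i)) = fun i => ψ (unit i) • x i := by
    funext i
    rw [map_smul, smul_eq_mul, smul_eq_mul, mul_comm]
  rw [h3] at h2
  exact h2.unique h1

theorem bidual_apply_eq {w : StrongDual ℝ (StrongDual ℝ CZero)}
    (h : Filter.Tendsto (fun i => w (coord i)) Filter.atTop (nhds 0))
    (ψ : StrongDual ℝ CZero) : w ψ = ψ (ofTendsto _ h) := by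
  have h1 := (hasSum_smul_coord ψ).mapL w
  have h2 := (hasSum_smul_coord ψ).mapL (ContinuousLinearMap.apply ℝ ℝ (ofTendsto _ h))
  have h3 : (fun i => w (ψ (unit i) • coord i)) = fun i => ψ (unit i) • w (coord i) := by
    funext i
    rw [map_smul]
  rw [h3] at h1
  exact h1.unique h2

end CZero

/-! ### Kalton graphs in `c₀` and their slopes -/

namespace KaltonVertex

open CZero hiding sub_apply smul_apply sum_apply

/-- The sum of the elements of the summing basis with indices in the shift of `n` by `k`. -/
noncomputable def vec {k : ℕ} (n : KaltonVertex k) : CZero := ∑ i, step (n i + k)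

theorem vec_apply {k : ℕ} (n : KaltonVertex k) (t : ℕ) : n.vec t = n.tailCount t := by
  simp [vec, tailCount]

theorem norm_vec_sub_le {k : ℕ} (n m : KaltonVertex k) : ‖n.vec - m.vec‖ ≤ dist n m := by
  rw [norm_le dist_nonneg]
  intro t
  rw [CZero.sub_apply, vec_apply, vec_apply]
  exact abs_tailCount_sub_le_dist n m t

theorem dist_le_two_mul_norm {k : ℕ} (n m : KaltonVertex k) :
    dist n m ≤ 2 * ‖n.vec - m.vec‖ := by
  refine dist_le_two_mul_of_abs_le fun t => ?_
  rw [← vec_apply, ← vec_apply]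
  exact abs_apply_le (n.vec - m.vec) t

/-- The normalized difference of the images of two vertices. -/
noncomputable def slope {k : ℕ} (n m : KaltonVertex k) : CZero :=
  (dist n m)⁻¹ • (n.vec - m.vec)

theorem norm_slope_le {k : ℕ} (n m : KaltonVertex k) : ‖slope n m‖ ≤ 1 := by
  rw [slope, norm_smul, norm_inv, Real.norm_of_nonneg dist_nonneg, inv_mul_eq_div]
  exact div_le_one_of_le₀ (norm_vec_sub_le n m) dist_nonneg

theorem dist_smul_slope {k : ℕ} (n m : KaltonVertex k) :
    dist n m • slope n m = n.vec - m.vec := by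
  by_cases h : n = m
  · simp [h]
  · rw [slope, smul_inv_smul₀ (dist_ne_zero.2 h)]

theorem inv_dist_le_one {k : ℕ} (n m : KaltonVertex k) : (dist n m)⁻¹ ≤ 1 := by
  change ((graph k).dist n m : ℝ)⁻¹ ≤ 1
  exact Nat.cast_inv_le_one _

theorem abs_apply_slope_le {k : ℕ} (n m : KaltonVertex k) {h : StrongDual ℝ CZero} {A : ℝ}
    (hA : ∀ r, k ≤ r → |h (step r)| ≤ A) : |h (slope n m)| ≤ 2 * k * A := by
  have h1 : ∀ l : KaltonVertex k, |h l.vec| ≤ k * A := by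
    intro l
    rw [vec, map_sum]
    refine (Finset.abs_sum_le_sum_abs _ _).trans ?_
    refine (Finset.sum_le_card_nsmul _ _ A fun i _ => hA _ (by omega)).trans ?_
    simp
  have h2 : |h (n.vec - m.vec)| ≤ 2 * k * A := by
    rw [map_sub]
    have := abs_sub (h n.vec) (h m.vec)
    linarith [h1 n, h1 m]
  rw [slope, map_smul, smul_eq_mul, abs_mul, abs_of_nonneg (inv_nonneg.2 dist_nonneg)]
  exact (mul_le_of_le_one_left (abs_nonneg _) (inv_dist_le_one n m)).trans h2

/-- The set of all normalized differences of images of vertices of the Kalton graphs. -/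
def slopes : Set CZero := {x | ∃ (k : ℕ) (n m : KaltonVertex k), slope n m = x}

/-! ### Oscillation contradicts boundedness on test functionals -/

section Averaging

variable {w : StrongDual ℝ (StrongDual ℝ CZero)} {δ : ℝ}

/-- The functional `coord q - coord p` is nonzero on `step r` only for `r` between `p` and `q`.
Successive pairs are chosen further out, so these ranges are disjoint and the values on `step r` do
not add up. -/
theorem exists_block_sum
    (hw : ∀ L : ℕ, ∃ p q : ℕ, L ≤ p ∧ L ≤ q ∧ δ ≤ w (coord q - coord p)) (M : ℕ) :
    ∃ (h : StrongDual ℝ CZero) (L : ℕ), ‖h‖ ≤ 2 * M ∧ M * δ ≤ w h ∧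
      (∀ r, |h (step r)| ≤ 1) ∧ ∀ r, L ≤ r → h (step r) = 0 := by
  induction M with
  | zero => exact ⟨0, 0, by simp⟩
  | succ M ih =>
    obtain ⟨h, L, h1, h2, h3, h4⟩ := ih
    obtain ⟨p, q, hp, hq, hpq⟩ := hw L
    refine ⟨h + (coord q - coord p), max p q, ?_, ?_, fun r => ?_, fun r hr => ?_⟩
    · have := norm_add_le h (coord q - coord p)
      have := norm_sub_le (coord q) (coord p)
      have := norm_coord_le p
      have := norm_coord_le q
      push_cast
      linarith
    · rw [map_add]
      push_cast
      linarith
    · simp only [_root_.add_apply, _root_.sub_apply, coord_apply, step_apply]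
      rcases lt_or_ge r L with hr | hr
      · rw [if_neg (by omega), if_neg (by omega), sub_self, add_zero]
        exact h3 r
      · rw [h4 r hr]
        split_ifs <;> norm_num
    · simp only [_root_.add_apply, _root_.sub_apply, coord_apply, step_apply]
      rw [h4 r (by omega), if_pos (by omega), if_pos (by omega)]
      norm_num

theorem exists_sum_of_block_averages
    (hw : ∀ L : ℕ, ∃ p q : ℕ, L ≤ p ∧ L ≤ q ∧ δ ≤ w (coord q - coord p)) {η : ℝ} (hη : 0 < η)
    (R : ℕ) :
    ∃ (H : StrongDual ℝ CZero) (L : ℕ), ‖H‖ ≤ 2 * R ∧ R * δ ≤ w H ∧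
      (∀ x ∈ slopes, |H x| ≤ 2 + R * η) ∧ ∀ r, L ≤ r → H (step r) = 0 := by
  induction R with
  | zero => exact ⟨0, 0, by simp⟩
  | succ R ih =>
    obtain ⟨H, L, h1, h2, h3, h4⟩ := ih
    -- This length makes the average at most `2 * k / M ≤ η` on slopes with `k < L`.
    obtain ⟨M', hM'⟩ := exists_nat_gt (2 * L / η)
    obtain ⟨M, hM, hM0⟩ : ∃ M : ℕ, 2 * L / η ≤ M ∧ (0 : ℝ) < M :=
      ⟨M' + 1, by push_cast; linarith, by positivity⟩
    obtain ⟨h, L', g1, g2, g3, g4⟩ := exists_block_sum hw M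
    have f1 : ‖(M : ℝ)⁻¹ • h‖ ≤ 2 := by
      rw [norm_smul, norm_inv, Real.norm_of_nonneg hM0.le, inv_mul_le_iff₀ hM0]
      linarith
    refine ⟨H + (M : ℝ)⁻¹ • h, max L L', ?_, ?_, fun x hx => ?_, fun r hr => ?_⟩
    · have := norm_add_le H ((M : ℝ)⁻¹ • h)
      push_cast
      linarith
    · have : δ ≤ (M : ℝ)⁻¹ * w h := by rwa [le_inv_mul_iff₀ hM0]
      rw [map_add, map_smul, smul_eq_mul]
      push_cast
      linarith
    · have hHx := h3 x hx
      obtain ⟨k, n, m, rfl⟩ := hx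
      rw [_root_.add_apply]
      have hadd := abs_add_le (H (slope n m)) (((M : ℝ)⁻¹ • h) (slope n m))
      rw [Nat.cast_succ]
      -- If `L ≤ k`, the old sum `H` vanishes on the slope, and the new average contributes at most
      -- its norm 2. Otherwise the new average adds at most `η`.
      rcases le_or_gt L k with hk | hk
      · have hH0 : |H (slope n m)| ≤ 2 * k * 0 :=
          abs_apply_slope_le n m fun r hr => by rw [h4 r (hk.trans hr), abs_zero]
        have hf : |((M : ℝ)⁻¹ • h) (slope n m)| ≤ 2 :=
          (ContinuousLinearMap.le_opNorm _ _).trans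
            ((mul_le_of_le_one_right (norm_nonneg _) (norm_slope_le n m)).trans f1)
        have : 0 ≤ (R + 1) * η := by positivity
        linarith
      · have hf : |((M : ℝ)⁻¹ • h) (slope n m)| ≤ 2 * k * (M : ℝ)⁻¹ := by
          refine abs_apply_slope_le n m fun r _ => ?_
          rw [_root_.smul_apply, smul_eq_mul, abs_mul, abs_of_pos (inv_pos.2 hM0)]
          exact mul_le_of_le_one_right (inv_pos.2 hM0).le (g3 r)
        have hkL : (k : ℝ) ≤ L := by exact_mod_cast hk.le
        have hη' : 2 * k * (M : ℝ)⁻¹ ≤ η := by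
          rw [mul_inv_le_iff₀ hM0]
          rw [div_le_iff₀ hη] at hM
          linarith
        linarith
    · rw [_root_.add_apply, _root_.smul_apply, h4 r (by omega), g4 r (by omega)]
      simp

/-- A bidual vector of `c₀` which is bounded on the test functionals for the slopes of the Kalton
graphs is a convergent sequence. -/
theorem cauchySeq_of_forall_testSet {C : ℝ}
    (hC : ∀ n, ∀ f ∈ Interpolation.testSet slopes n, |w f| ≤ C) :
    CauchySeq fun i => w (coord i) := by
  by_contra hcon
  obtain ⟨δ, hδ, hw⟩ : ∃ δ > 0, ∀ L : ℕ, ∃ p q : ℕ, L ≤ p ∧ L ≤ q ∧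
      δ ≤ w (coord q - coord p) := by
    rw [Metric.cauchySeq_iff] at hcon
    push Not at hcon
    obtain ⟨δ, hδ, h⟩ := hcon
    refine ⟨δ, hδ, fun L => ?_⟩
    obtain ⟨p, hp, q, hq, hpq⟩ := h L
    rw [Real.dist_eq] at hpq
    rcases le_abs.1 hpq with h1 | h1
    · exact ⟨q, p, hq, hp, by rwa [map_sub]⟩
    · exact ⟨p, q, hp, hq, by rw [map_sub]; linarith⟩
  obtain ⟨n, hn⟩ := pow_unbounded_of_one_lt (C / δ) one_lt_two
  rw [div_lt_iff₀ hδ] at hn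
  set t : ℝ := 2 ^ n with ht
  have ht0 : 0 < t := by positivity
  -- With `8 * t ^ 2` blocks, the multiple `H / (8 * t)` has norm at most `2 * t`, is at most `4 /
  -- (8 * t) = 1 / (2 * t)` on slopes, and has `w`-value at least `t * δ > C`.
  obtain ⟨H, -, h1, h2, h3, -⟩ := exists_sum_of_block_averages hw
    (η := 1 / (4 * t ^ 2)) (by positivity) (8 * (2 ^ n) ^ 2)
  have hR : ((8 * (2 ^ n) ^ 2 : ℕ) : ℝ) = 8 * t ^ 2 := by push_cast; rfl
  rw [hR] at h1 h2 h3
  have hc : 0 < 1 / (8 * t) := by positivity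
  have hmem : (1 / (8 * t)) • H ∈ Interpolation.testSet slopes (n + 1) := by
    refine ⟨?_, fun x hx => ?_⟩
    · rw [norm_smul, Real.norm_of_nonneg hc.le, pow_succ, ← ht]
      calc 1 / (8 * t) * ‖H‖ ≤ 1 / (8 * t) * (2 * (8 * t ^ 2)) :=
            mul_le_mul_of_nonneg_left h1 hc.le
        _ = t * 2 := by field_simp
    · rw [_root_.smul_apply, smul_eq_mul, abs_mul, abs_of_pos hc]
      calc 1 / (8 * t) * |H x| ≤ 1 / (8 * t) * (2 + 8 * t ^ 2 * (1 / (4 * t ^ 2))) :=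
            mul_le_mul_of_nonneg_left (h3 x hx) hc.le
        _ = (1 / 2) ^ (n + 1) := by
            rw [pow_succ (1 / 2 : ℝ) n, one_div_pow, ← ht]
            field_simp
            norm_num
  have h4 := hC _ _ hmem
  rw [map_smul, smul_eq_mul, abs_mul, abs_of_pos hc] at h4
  have h5 : t * δ ≤ 1 / (8 * t) * |w H| := by
    calc t * δ = 1 / (8 * t) * (8 * t ^ 2 * δ) := by field_simp
      _ ≤ 1 / (8 * t) * |w H| := mul_le_mul_of_nonneg_left (h2.trans (le_abs_self _)) hc.le
  linarith

end Averaging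

end KaltonVertex

/-! ### Quasi-reflexivity and the embeddings -/

theorem finiteDimensional_quotient_of_ker_le {V : Type*} [AddCommGroup V] [Module ℝ V]
    {R : Submodule ℝ V} (l : V →ₗ[ℝ] ℝ) (h : LinearMap.ker l ≤ R) :
    FiniteDimensional ℝ (V ⧸ R) := by
  have : FiniteDimensional ℝ (V ⧸ LinearMap.ker l) :=
    Module.Finite.equiv l.quotKerEquivRange.symm
  exact Module.Finite.of_surjective (Submodule.factor h) (Submodule.factor_surjective h)

open KaltonVertex Interpolation

theorem isQuasiReflexive_space_slopes : IsQuasiReflexive (Space slopes) := by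
  have hconv : ∀ Φ : StrongDual ℝ (StrongDual ℝ (Space slopes)),
      ∃ l, Filter.Tendsto (fun i => Φ ((CZero.coord i).comp (toAmbient slopes)))
        Filter.atTop (nhds l) := fun Φ =>
    cauchySeq_tendsto_of_complete <| cauchySeq_of_forall_testSet
      (w := Φ.comp (ContinuousLinearMap.precomp ℝ (toAmbient slopes)))
      (fun _ _ hf => abs_bidual_apply_le Φ hf)
  choose l hl using hconv
  let lim : StrongDual ℝ (StrongDual ℝ (Space slopes)) →ₗ[ℝ] ℝ :=
    { toFun := l
      map_add' := fun Φ Ψ => tendsto_nhds_unique (hl _) ((hl Φ).add (hl Ψ))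
      map_smul' := fun c Φ => tendsto_nhds_unique (hl _) ((hl Φ).const_smul c) }
  have hker : LinearMap.ker lim ≤ (NormedSpace.inclusionInDoubleDual ℝ (Space slopes)).range := by
    intro Φ hΦ
    have h0 := hl Φ
    rw [show l Φ = 0 from hΦ] at h0
    exact mem_range_of_forall_apply_eq fun ψ => CZero.bidual_apply_eq
      (w := Φ.comp (ContinuousLinearMap.precomp ℝ (toAmbient slopes))) h0 ψ
  exact finiteDimensional_quotient_of_ker_le lim hker

theorem equiLipschitzEmbeds_space_slopes :
    EquiLipschitzEmbeds (fun k : ℕ => KaltonVertex k) (Space slopes) := by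
  have hz : ∀ (k : ℕ) (n m : KaltonVertex k), ∃ z : Space slopes,
      toAmbient slopes z = slope n m ∧ ‖z‖ ≤ 2 := fun k n m =>
    exists_toAmbient_eq_of_mem ⟨k, n, m, rfl⟩ (norm_slope_le n m)
  choose z hz hz2 using hz
  have base : ∀ k : ℕ, Nonempty (KaltonVertex k) := fun k => (graph_connected k).nonempty
  -- With a base vertex `o`, the image of `n` is the lift of `n.vec - o.vec`. Injectivity of
  -- `toAmbient` makes differences of images multiples of lifted slopes: the norm bound 2 of these
  -- lifts gives the upper constant, the norm in `c₀` the lower one.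
  refine ⟨1 / 2, 2, by norm_num, by norm_num,
    fun k n => dist n (base k).some • z k n (base k).some, fun k n m => ?_⟩
  set o := (base k).some
  have h1 : dist n o • z k n o - dist m o • z k m o = dist n m • z k n m := by
    apply toAmbient_injective
    rw [map_sub, map_smul, map_smul, map_smul, hz, hz, hz, dist_smul_slope, dist_smul_slope,
      dist_smul_slope]
    abel
  rw [dist_eq_norm, h1]
  constructor
  · have h2 := norm_toAmbient_le (dist n m • z k n m)
    rw [map_smul, hz, dist_smul_slope] at h2
    linarith [dist_le_two_mul_norm n m]
  · rw [norm_smul, Real.norm_of_nonneg dist_nonneg, mul_comm]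
    exact mul_le_mul_of_nonneg_right (hz2 k n m) dist_nonneg

theorem proposition4p3 :
    ∃ (X : Type) (_ : NormedAddCommGroup X) (_ : NormedSpace ℝ X) (_ : CompleteSpace X),
      IsQuasiReflexive X ∧ EquiLipschitzEmbeds (fun k : ℕ => KaltonVertex k) X :=
  ⟨Space slopes, inferInstance, inferInstance, inferInstance, isQuasiReflexive_space_slopes,
    equiLipschitzEmbeds_space_slopes⟩
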